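/- Let $K$ be a field and let $X_\bullet=\{X_t\}_{t\in\mathbb R}$ be a filtration of topological spaces, i.e. spaces with $X_t\subseteq X_s$ (continuous inclusion) for $t\le s$; more generally, $X_\bullet$ may be any functor from $(\mathbb R,\le)$ to topological spaces. Let $\mathbf H^*(X)=\bigoplus_{p\ge 0}\mathbf H^p(X)$ be the singular cohomology ring over $K$ with the cup product, and $\mathbf H^+(X)=\bigoplus_{p\ge 1}\mathbf H^p(X)$. The length $\mathbf{len}(R)\in\mathbb N\cup\{\infty\}$ of a graded ring $R$ is the supremum of all $\ell\ge 0$ such that some product of $\ell$ homogeneous elements of positive degree of $R$ is non-zero (with $\sup\emptyset=0$). The persistent cup-length invariant of $X_\bullet$ is $$\mathbf{cup}(X_\bullet)([a,b])=\mathbf{len}\bigl(\operatorname{im}(\mathbf H^*(X_b)\to\mathbf H^*(X_a))\bigr),\qquad a\le b .$$ A family of representative cocycles $\boldsymbol\sigma=\{\sigma_I\}$ for the barcode of $\mathbf H^+(X_\bullet)$ consists of a multiset of non-empty intervals $I\subseteq\mathbb R$ (the bars), each with a degree $p_I\ge 1$, and of a $p_I$-cocycle $\sigma_I$ for each bar $I$,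 given by cocycles on the spaces $X_t$, $t\in I$, that restrict to each other (if $I$ has a largest element $d$, this is just a cocycle on $X_d$), such that the class of the restriction of $\sigma_I$ to $X_s$ is zero for every $s\notin I$ lying below $I$, and such that for each $t\in\mathbb R$ the classes $[\sigma_I]_t$ of the restrictions to $X_t$, over all bars $I\ni t$, form a linear basis of $\mathbf H^+(X_t)$. For $t\notin I$ put $[\sigma_I]_t:=0$. The support of a product is $$\operatorname{supp}(\sigma_{I_1}\smile\dots\smile\sigma_{I_\ell})=\{t\in\mathbb R : [\sigma_{I_1}]_t\smile\dots\smile[\sigma_{I_\ell}]_t\neq 0\},$$ and the persistent cup-length diagram assigns to an interval $J$ the value $$\mathbf{dgm}(\mathbf{cup}(X_\bullet),\boldsymbol\sigma)(J)=\sup\{\ell\ge 1 : J=\operatorname{supp}(\sigma_{I_1}\smile\dots\smile\sigma_{I_\ell})\text{ for some bars } I_1,\dots,I_\ell\}\in\mathbb N\cup\{\infty\},\qquad \sup\emptyset=0 .$$ Let $\mathcal{I}nt$ be one of the following classes of non-empty intervals of $\mathbb R$, bounded or unbounded: those whose finite left end is always included, or always excluded, or unrestricted, and whose finite right end is always included,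 or always excluded, or unrestricted (this covers the closed-closed, closed-open, open-closed and open-open intervals, and the class of all intervals). Suppose that all bars of $\boldsymbol\sigma$ belong to $\mathcal{I}nt$. **Theorem.** For all real $a\le b$, $$\mathbf{cup}(X_\bullet)([a,b])=\sup_{J\in\mathcal{I}nt,\ J\supseteq[a,b]}\mathbf{dgm}(\mathbf{cup}(X_\bullet),\boldsymbol\sigma)(J),$$ and if $\mathbf{cup}(X_\bullet)([a,b])$ is finite, then the supremum is a maximum: $$\mathbf{cup}(X_\bullet)([a,b])=\max_{J\in\mathcal{I}nt,\ J\supseteq[a,b]}\mathbf{dgm}(\mathbf{cup}(X_\bullet),\boldsymbol\sigma)(J).$$ -/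

import Mathlib

open CategoryTheory

universe u v w

noncomputable section

namespace PersistentCup

open DirectSum Opposite

/-! ### Cochains of a simplicial set and the cup product -/

section Cochains

set_option linter.unusedSimpArgs false
set_option linter.unnecessarySeqFocus false

open scoped Simplicial

/-- The inclusion of the front face `{0, …, p}` of `{0, …, n}`, where `n = p + q`. -/
def frontMap {p q n : ℕ} (h : p + q = n) : ⦋p⦌ ⟶ ⦋n⦌ :=
  SimplexCategory.mkHom
    { toFun := fun i => ⟨i.1, by have := i.2; omega⟩
      monotone' := fun _ _ hij => hij }

/-- The inclusion of the back face `{p, …, n}` of `{0, …, n}`, where `n = p + q`. -/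
def backMap {p q n : ℕ} (h : p + q = n) : ⦋q⦌ ⟶ ⦋n⦌ :=
  SimplexCategory.mkHom
    { toFun := fun j => ⟨p + j.1, by have := j.2; omega⟩
      monotone' := fun _ _ hij => Nat.add_le_add_left hij p }

variable (K : Type v) [Field K] (S : SSet.{u})

/-- The `p`-cochains of `S` with coefficients in `K`: a linear form on the `p`-chains is the same
as a function on the `p`-simplices. -/
abbrev Cochain (p : ℕ) : Type max u v := S _⦋p⦌ → K

variable {S}

/-- The coboundary, `(d f)(τ) = ∑ i, (-1)^i f(∂ᵢ τ)`. -/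
def coboundary (p : ℕ) : Cochain K S p →ₗ[K] Cochain K S (p + 1) where
  toFun f τ := ∑ i : Fin (p + 2), (-1 : K) ^ (i : ℕ) * f (S.map (SimplexCategory.δ i).op τ)
  map_add' f g := by
    funext τ
    simp [mul_add, Finset.sum_add_distrib]
  map_smul' c f := by
    funext τ
    simp only [Pi.smul_apply, smul_eq_mul, RingHom.id_apply, Finset.mul_sum]
    exact Finset.sum_congr rfl fun i _ => by ring

/-- The cup product of cochains, `(f ⌣ g)[τ₀,…,τₙ] = f[τ₀,…,τₚ] · g[τₚ,…,τₙ]`, `n = p + q`. -/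
def cupCochain {p q n : ℕ} (h : p + q = n) :
    Cochain K S p →ₗ[K] Cochain K S q →ₗ[K] Cochain K S n :=
  LinearMap.mk₂ K
    (fun f g τ => f (S.map (frontMap h).op τ) * g (S.map (backMap h).op τ))
    (fun f f' g => by funext τ; simp [add_mul])
    (fun c f g => by funext τ; simp [mul_assoc])
    (fun f g g' => by funext τ; simp [mul_add])
    (fun c f g => by funext τ; simp [mul_left_comm])

theorem cupCochain_apply {p q n : ℕ} (h : p + q = n) (f : Cochain K S p) (g : Cochain K S q)
    (τ : S _⦋n⦌) :
    cupCochain K h f g τ = f (S.map (frontMap h).op τ) * g (S.map (backMap h).op τ) := rfl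

theorem map_map_op (S : SSet.{u}) {a b c : SimplexCategory} (f : a ⟶ b) (g : b ⟶ c)
    (τ : S.obj (op c)) : S.map f.op (S.map g.op τ) = S.map (f ≫ g).op τ := by
  rw [op_comp, S.map_comp]; rfl

theorem simplexHom_ext {a b : ℕ} {f g : ⦋a⦌ ⟶ ⦋b⦌}
    (h : ∀ k : Fin (a + 1), (f.toOrderHom k : Fin (b + 1)).val = (g.toOrderHom k : Fin (b + 1)).val) :
    f = g := by
  apply SimplexCategory.Hom.ext
  ext k
  exact h k

theorem comp_val {a b c : ℕ} (f : ⦋a⦌ ⟶ ⦋b⦌) (g : ⦋b⦌ ⟶ ⦋c⦌) (k : Fin (a + 1)) :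
    ((f ≫ g).toOrderHom k : Fin (c + 1)).val = (g.toOrderHom (f.toOrderHom k) : Fin (c + 1)).val :=
  rfl

/-- The values of the coface map that skips `i`. -/
def skip (i k : ℕ) : ℕ := if k < i then k else k + 1

theorem δ_val {n : ℕ} (i : Fin (n + 2)) (k : Fin (n + 1)) :
    ((SimplexCategory.δ i).toOrderHom k : Fin (n + 2)).val =
      skip i.val k.val := by
  change (i.succAbove k).val = _
  unfold skip Fin.succAbove
  by_cases h : k.val < i.val
  · rw [if_pos h, if_pos (show k.castSucc < i from h)]; rfl
  · rw [if_neg h, if_neg (show ¬ k.castSucc < i from h)]; rfl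

theorem frontMap_val {p q n : ℕ} (h : p + q = n) (k : Fin (p + 1)) :
    ((frontMap h).toOrderHom k : Fin (n + 1)).val = k.val := rfl

theorem backMap_val {p q n : ℕ} (h : p + q = n) (k : Fin (q + 1)) :
    ((backMap h).toOrderHom k : Fin (n + 1)).val = p + k.val := rfl

theorem frontMap_δ_low {p q : ℕ} (i : Fin (p + 1)) :
    frontMap (rfl : p + q = p + q) ≫
        SimplexCategory.δ (⟨i.1, by have := i.2; omega⟩ : Fin (p + q + 2)) =
      SimplexCategory.δ (i.castSucc) ≫ frontMap (by omega : (p + 1) + q = p + q + 1) := by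
  refine simplexHom_ext fun k => ?_
  have := k.2
  have := i.2
  simp only [comp_val, δ_val, frontMap_val, backMap_val, Fin.val_castSucc, Fin.val_succ,
    Fin.val_last, Fin.val_zero]

theorem backMap_δ_low {p q : ℕ} (i : Fin (p + 1)) :
    backMap (rfl : p + q = p + q) ≫
        SimplexCategory.δ (⟨i.1, by have := i.2; omega⟩ : Fin (p + q + 2)) =
      backMap (by omega : (p + 1) + q = p + q + 1) := by
  refine simplexHom_ext fun k => ?_
  have := k.2
  have := i.2
  simp only [comp_val, δ_val, frontMap_val, backMap_val, Fin.val_castSucc, Fin.val_succ,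
    Fin.val_last, Fin.val_zero]
  generalize k.val = kk at *
  unfold skip
  split_ifs <;> omega

theorem frontMap_δ_high {p q : ℕ} (j : Fin (q + 1)) :
    frontMap (rfl : p + q = p + q) ≫
        SimplexCategory.δ (⟨p + 1 + j.1, by have := j.2; omega⟩ : Fin (p + q + 2)) =
      frontMap (by omega : p + (q + 1) = p + q + 1) := by
  refine simplexHom_ext fun k => ?_
  have := k.2
  have := j.2
  simp only [comp_val, δ_val, frontMap_val, backMap_val, Fin.val_castSucc, Fin.val_succ,
    Fin.val_last, Fin.val_zero]
  generalize k.val = kk at *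
  unfold skip
  split_ifs <;> omega

theorem backMap_δ_high {p q : ℕ} (j : Fin (q + 1)) :
    backMap (rfl : p + q = p + q) ≫
        SimplexCategory.δ (⟨p + 1 + j.1, by have := j.2; omega⟩ : Fin (p + q + 2)) =
      SimplexCategory.δ j.succ ≫ backMap (by omega : p + (q + 1) = p + q + 1) := by
  refine simplexHom_ext fun k => ?_
  have := k.2
  have := j.2
  simp only [comp_val, δ_val, frontMap_val, backMap_val, Fin.val_castSucc, Fin.val_succ,
    Fin.val_last, Fin.val_zero]
  generalize k.val = kk at *
  unfold skip
  split_ifs <;> omega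

theorem δ_last_frontMap {p q : ℕ} :
    SimplexCategory.δ (Fin.last (p + 1)) ≫ frontMap (by omega : (p + 1) + q = p + q + 1) =
      frontMap (by omega : p + (q + 1) = p + q + 1) := by
  refine simplexHom_ext fun k => ?_
  have := k.2
  simp only [comp_val, δ_val, frontMap_val, backMap_val, Fin.val_castSucc, Fin.val_succ,
    Fin.val_last, Fin.val_zero]
  generalize k.val = kk at *
  unfold skip
  split_ifs <;> omega

theorem δ_zero_backMap {p q : ℕ} :
    SimplexCategory.δ 0 ≫ backMap (by omega : p + (q + 1) = p + q + 1) =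
      backMap (by omega : (p + 1) + q = p + q + 1) := by
  refine simplexHom_ext fun k => ?_
  have := k.2
  simp only [comp_val, δ_val, frontMap_val, backMap_val, Fin.val_castSucc, Fin.val_succ,
    Fin.val_last, Fin.val_zero]
  generalize k.val = kk at *
  unfold skip
  split_ifs <;> omega

/-- The Leibniz rule. -/
theorem coboundary_cup {p q : ℕ} (f : Cochain K S p) (g : Cochain K S q) :
    coboundary K (p + q) (cupCochain K rfl f g) =
      cupCochain K (by omega : (p + 1) + q = p + q + 1) (coboundary K p f) g +
        (-1 : K) ^ p •
          cupCochain K (by omega : p + (q + 1) = p + q + 1) f (coboundary K q g) := by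
  funext τ
  simp only [coboundary, LinearMap.coe_mk, AddHom.coe_mk, cupCochain_apply, Pi.add_apply,
    Pi.smul_apply, smul_eq_mul, map_map_op]
  rw [← (finCongr (by omega : (p + 1) + (q + 1) = p + q + 2)).sum_comp, Fin.sum_univ_add,
    Fin.sum_univ_castSucc (n := p + 1), Fin.sum_univ_succ (n := q + 1), δ_last_frontMap,
    δ_zero_backMap]
  have h1 : ∀ i : Fin (p + 1),
      (-1 : K) ^ ((finCongr (by omega : (p + 1) + (q + 1) = p + q + 2)
        (Fin.castAdd (q + 1) i) : Fin (p + q + 2)) : ℕ) *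
        (f (S.map (frontMap (rfl : p + q = p + q) ≫ SimplexCategory.δ
          (finCongr (by omega : (p + 1) + (q + 1) = p + q + 2) (Fin.castAdd (q + 1) i))).op τ) *
        g (S.map (backMap (rfl : p + q = p + q) ≫ SimplexCategory.δ
          (finCongr (by omega : (p + 1) + (q + 1) = p + q + 2) (Fin.castAdd (q + 1) i))).op τ)) =
      ((-1 : K) ^ ((i.castSucc : Fin (p + 2)) : ℕ) *
        f (S.map (SimplexCategory.δ i.castSucc ≫
          frontMap (by omega : (p + 1) + q = p + q + 1)).op τ)) *
        g (S.map (backMap (by omega : (p + 1) + q = p + q + 1)).op τ) := by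
    intro i
    rw [← frontMap_δ_low (q := q) i, ← backMap_δ_low (q := q) i, mul_assoc]
    rfl
  have h2 : ∀ j : Fin (q + 1),
      (-1 : K) ^ ((finCongr (by omega : (p + 1) + (q + 1) = p + q + 2)
        (Fin.natAdd (p + 1) j) : Fin (p + q + 2)) : ℕ) *
        (f (S.map (frontMap (rfl : p + q = p + q) ≫ SimplexCategory.δ
          (finCongr (by omega : (p + 1) + (q + 1) = p + q + 2) (Fin.natAdd (p + 1) j))).op τ) *
        g (S.map (backMap (rfl : p + q = p + q) ≫ SimplexCategory.δ
          (finCongr (by omega : (p + 1) + (q + 1) = p + q + 2) (Fin.natAdd (p + 1) j))).op τ)) =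
      (-1 : K) ^ p * (f (S.map (frontMap (by omega : p + (q + 1) = p + q + 1)).op τ) *
        ((-1 : K) ^ ((j.succ : Fin (q + 2)) : ℕ) *
          g (S.map (SimplexCategory.δ j.succ ≫
            backMap (by omega : p + (q + 1) = p + q + 1)).op τ))) := by
    intro j
    rw [← frontMap_δ_high (q := q) j, ← backMap_δ_high (q := q) j]
    have : (-1 : K) ^ (p + 1 + j.1) = (-1) ^ p * (-1) ^ (j.1 + 1) := by
      rw [← pow_add]; congr 1; omega
    change (-1 : K) ^ (p + 1 + j.1) * (_ * _) = (-1 : K) ^ p * (_ * ((-1 : K) ^ (j.1 + 1) * _))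
    rw [this]
    simp only [mul_assoc, mul_left_comm]
    rfl
  rw [Finset.sum_congr rfl fun i _ => h1 i, Finset.sum_congr rfl fun j _ => h2 j, add_mul,
    Finset.sum_mul, mul_add, mul_add, Finset.mul_sum, Finset.mul_sum]
  simp only [Fin.val_last, Fin.val_zero, pow_zero, one_mul, pow_succ]
  ring

end Cochains

/-! ### The cohomology ring -/

section Cohomology

variable (K : Type v) [Field K] (S : SSet.{u})

/-- The `p`-cocycles. -/
def Cocycle (p : ℕ) : Submodule K (Cochain K S p) := LinearMap.ker (coboundary K p)

/-- The `p`-coboundaries. -/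
def Coboundaries : (p : ℕ) → Submodule K (Cochain K S p)
  | 0 => ⊥
  | p + 1 => LinearMap.range (coboundary K p)

open scoped Simplicial

/-- Cohomology in degree `p`: cocycles modulo coboundaries. -/
def Cohomology (p : ℕ) : Type max u v :=
  Cocycle K S p ⧸ (Coboundaries K S p).submoduleOf (Cocycle K S p)

instance (p : ℕ) : AddCommGroup (Cohomology K S p) :=
  inferInstanceAs (AddCommGroup (Cocycle K S p ⧸ (Coboundaries K S p).submoduleOf (Cocycle K S p)))

instance (p : ℕ) : Module K (Cohomology K S p) :=
  inferInstanceAs (Module K (Cocycle K S p ⧸ (Coboundaries K S p).submoduleOf (Cocycle K S p)))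

variable {S}

/-- The cohomology class of a cocycle. -/
def cohClass {p : ℕ} : Cocycle K S p →ₗ[K] Cohomology K S p := Submodule.mkQ _

theorem cohClass_surjective {p : ℕ} : Function.Surjective (cohClass K (S := S) (p := p)) :=
  Submodule.mkQ_surjective _

variable {K}

theorem cohClass_eq_zero {p : ℕ} (z : Cocycle K S p) :
    cohClass K z = 0 ↔ (z : Cochain K S p) ∈ Coboundaries K S p := by
  exact Submodule.Quotient.mk_eq_zero _

theorem cup_mem_cocycle {p q n : ℕ} (h : p + q = n) {f : Cochain K S p} {g : Cochain K S q}
    (hf : f ∈ Cocycle K S p) (hg : g ∈ Cocycle K S q) :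
    cupCochain K h f g ∈ Cocycle K S n := by
  subst h
  have hf' : coboundary K p f = 0 := hf
  have hg' : coboundary K q g = 0 := hg
  simp [Cocycle, LinearMap.mem_ker, coboundary_cup, hf', hg']

theorem cup_mem_left {p q n : ℕ} (h : p + q = n) {f : Cochain K S p} {g : Cochain K S q}
    (hf : f ∈ Coboundaries K S p) (hg : g ∈ Cocycle K S q) :
    cupCochain K h f g ∈ Coboundaries K S n := by
  cases p with
  | zero =>
    have : f = 0 := hf
    simp [this]
  | succ p =>
    obtain ⟨k, rfl⟩ := hf
    obtain rfl : n = p + q + 1 := by omega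
    have hg' : coboundary K q g = 0 := hg
    exact ⟨cupCochain K rfl k g, by simp [coboundary_cup, hg']⟩

theorem cup_mem_right {p q n : ℕ} (h : p + q = n) {f : Cochain K S p} {g : Cochain K S q}
    (hf : f ∈ Cocycle K S p) (hg : g ∈ Coboundaries K S q) :
    cupCochain K h f g ∈ Coboundaries K S n := by
  cases q with
  | zero =>
    have : g = 0 := hg
    simp [this]
  | succ q =>
    obtain ⟨k, rfl⟩ := hg
    obtain rfl : n = p + q + 1 := by omega
    have hf' : coboundary K p f = 0 := hf
    refine ⟨(-1 : K) ^ p • cupCochain K rfl f k, ?_⟩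
    rw [map_smul, coboundary_cup, hf', map_zero, LinearMap.zero_apply, zero_add, smul_smul,
      ← mul_pow]
    simp

variable (K)

/-- The cup product of cocycles. -/
def cupCocycle {p q n : ℕ} (h : p + q = n) :
    Cocycle K S p →ₗ[K] Cocycle K S q →ₗ[K] Cocycle K S n :=
  LinearMap.mk₂ K
    (fun f g => ⟨cupCochain K h f g, cup_mem_cocycle h f.2 g.2⟩)
    (fun f f' g => by ext1; simp)
    (fun c f g => by ext1; simp)
    (fun f g g' => by ext1; simp)
    (fun c f g => by ext1; simp)

/-- The cup product `Hᵖ × H^q → H^(p+q)`, induced by the cup product of cocycles. -/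
def cup {p q n : ℕ} (h : p + q = n) :
    Cohomology K S p →ₗ[K] Cohomology K S q →ₗ[K] Cohomology K S n :=
  Submodule.liftQ _
    (LinearMap.flip (Submodule.liftQ _
      (LinearMap.flip ((cupCocycle K h).compr₂ (cohClass K)))
      (fun g hg => by
        rw [LinearMap.mem_ker]
        ext1 f
        exact (cohClass_eq_zero _).2 (cup_mem_right h f.2 hg))))
    (fun f hf => by
      rw [LinearMap.mem_ker]
      refine LinearMap.ext fun g => ?_
      obtain ⟨g, rfl⟩ := cohClass_surjective K g
      exact (cohClass_eq_zero _).2 (cup_mem_left h hf g.2))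

theorem cup_cohClass {p q n : ℕ} (h : p + q = n) (f : Cocycle K S p) (g : Cocycle K S q) :
    cup K h (cohClass K f) (cohClass K g) = cohClass K (cupCocycle K h f g) := rfl

variable (S)

/-- The unit cocycle, with constant value `1` on the vertices. -/
def oneCocycle : Cocycle K S 0 :=
  ⟨fun _ => 1, by
    change coboundary K 0 (fun _ => 1) = 0
    funext τ
    simp [coboundary, Fin.sum_univ_two]⟩

variable {S K}

theorem mk_cohClass_eq {m n : ℕ} (h : m = n) (f : Cocycle K S m) (g : Cocycle K S n)
    (hfg : ∀ τ : S _⦋n⦌, (f : Cochain K S m) (S.map (eqToHom (by rw [h]) : ⦋m⦌ ⟶ ⦋n⦌).op τ) =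
      (g : Cochain K S n) τ) :
    (GradedMonoid.mk m (cohClass K f) : GradedMonoid (Cohomology K S)) =
      GradedMonoid.mk n (cohClass K g) := by
  subst h
  have : f = g := by
    ext τ
    simpa using hfg τ
  rw [this]

theorem eqToHom_val {m n : ℕ} (h : m = n) (k : Fin (m + 1)) :
    ((eqToHom (by rw [h]) : ⦋m⦌ ⟶ ⦋n⦌).toOrderHom k : Fin (n + 1)).val = k.val := by
  subst h
  rfl

instance : GradedMonoid.GMul (Cohomology K S) where
  mul a b := cup K rfl a b

instance : GradedMonoid.GOne (Cohomology K S) where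
  one := cohClass K (oneCocycle K S)

/-- The graded ring structure given by the cup product. -/
instance : DirectSum.GRing (Cohomology K S) where
  mul_zero a := map_zero _
  zero_mul b := by
    change cup K rfl 0 b = 0
    rw [map_zero, LinearMap.zero_apply]
  mul_add a b c := map_add _ _ _
  add_mul a b c := by
    change cup K rfl (a + b) c = cup K rfl a c + cup K rfl b c
    rw [map_add, LinearMap.add_apply]
  one_mul := by
    rintro ⟨p, a⟩
    obtain ⟨f, rfl⟩ := cohClass_surjective K a
    refine mk_cohClass_eq (zero_add p) (cupCocycle K rfl (oneCocycle K S) f) f fun τ => ?_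
    change 1 * (f : Cochain K S p) _ = _
    rw [one_mul, map_map_op]
    have : backMap (rfl : 0 + p = 0 + p) ≫ eqToHom (by rw [zero_add]) = 𝟙 ⦋p⦌ := by
      refine simplexHom_ext fun k => ?_
      rw [comp_val, eqToHom_val (zero_add p), backMap_val, zero_add]
      rfl
    rw [this]
    simp
  mul_one := by
    rintro ⟨p, a⟩
    obtain ⟨f, rfl⟩ := cohClass_surjective K a
    refine mk_cohClass_eq (add_zero p) (cupCocycle K rfl f (oneCocycle K S)) f fun τ => ?_
    change (f : Cochain K S p) _ * 1 = _
    rw [mul_one, map_map_op]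
    have : frontMap (rfl : p + 0 = p + 0) ≫ eqToHom (by rw [add_zero]) = 𝟙 ⦋p⦌ := by
      refine simplexHom_ext fun k => ?_
      rw [comp_val, eqToHom_val (add_zero p), frontMap_val]
      rfl
    rw [this]
    simp
  mul_assoc := by
    rintro ⟨p, a⟩ ⟨q, b⟩ ⟨r, c⟩
    obtain ⟨f, rfl⟩ := cohClass_surjective K a
    obtain ⟨g, rfl⟩ := cohClass_surjective K b
    obtain ⟨k, rfl⟩ := cohClass_surjective K c
    refine mk_cohClass_eq (add_assoc p q r) (cupCocycle K rfl (cupCocycle K rfl f g) k)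
      (cupCocycle K rfl f (cupCocycle K rfl g k)) fun τ => ?_
    change ((f : Cochain K S p) _ * (g : Cochain K S q) _) * (k : Cochain K S r) _ =
      (f : Cochain K S p) _ * ((g : Cochain K S q) _ * (k : Cochain K S r) _)
    rw [mul_assoc]
    simp only [map_map_op]
    have e1 : frontMap (rfl : p + q = p + q) ≫ frontMap (rfl : p + q + r = p + q + r) ≫
        eqToHom (by rw [add_assoc]) = frontMap (rfl : p + (q + r) = p + (q + r)) := by
      refine simplexHom_ext fun x => ?_
      simp only [comp_val, eqToHom_val (add_assoc p q r), frontMap_val]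
    have e2 : backMap (rfl : p + q = p + q) ≫ frontMap (rfl : p + q + r = p + q + r) ≫
        eqToHom (by rw [add_assoc]) =
        frontMap (rfl : q + r = q + r) ≫ backMap (rfl : p + (q + r) = p + (q + r)) := by
      refine simplexHom_ext fun x => ?_
      simp only [comp_val, eqToHom_val (add_assoc p q r), frontMap_val, backMap_val]
    have e3 : backMap (rfl : p + q + r = p + q + r) ≫ eqToHom (by rw [add_assoc]) =
        backMap (rfl : q + r = q + r) ≫ backMap (rfl : p + (q + r) = p + (q + r)) := by
      refine simplexHom_ext fun x => ?_
      simp only [comp_val, eqToHom_val (add_assoc p q r), backMap_val, add_assoc]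
    rw [e1, e2, e3]
  natCast n := n • GradedMonoid.GOne.one
  natCast_zero := zero_smul _ _
  natCast_succ n := succ_nsmul _ _
  intCast n := n • GradedMonoid.GOne.one
  intCast_ofNat n := natCast_zsmul _ _
  intCast_negSucc_ofNat n := negSucc_zsmul _ _

variable (K S)

/-- The cohomology ring `H^* = ⨁ₚ Hᵖ`, with the cup product as multiplication. -/
abbrev CohomologyRing : Type max u v := ⨁ p, Cohomology K S p

/-- The degree-`p` part of the cohomology ring. -/
def degreePart (p : ℕ) : Submodule K (CohomologyRing K S) :=
  LinearMap.range (DirectSum.lof K ℕ (Cohomology K S) p)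

/-- The positive-degree part `H^+ = ⨁_{p ≥ 1} Hᵖ` of the cohomology ring. -/
def positivePart : Submodule K (CohomologyRing K S) :=
  ⨆ p : ℕ, degreePart K S (p + 1)

end Cohomology

/-! ### Functoriality -/

section Functoriality

variable (K : Type v) [Field K] {S T : SSet.{u}} (φ : S ⟶ T)

/-- Restriction (pull-back) of cochains along a map. -/
def pullCochain (p : ℕ) : Cochain K T p →ₗ[K] Cochain K S p where
  toFun f τ := f (φ.app _ τ)
  map_add' _ _ := rfl
  map_smul' _ _ := rfl

theorem app_map_op {a b : SimplexCategory} (f : a ⟶ b) (τ : S.obj (op b)) :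
    φ.app _ (S.map f.op τ) = T.map f.op (φ.app _ τ) :=
  congrArg (fun k => k τ) (φ.naturality f.op)

theorem coboundary_pull {p : ℕ} (f : Cochain K T p) :
    coboundary K p (pullCochain K φ p f) = pullCochain K φ (p + 1) (coboundary K p f) := by
  funext τ
  simp only [coboundary, pullCochain, LinearMap.coe_mk, AddHom.coe_mk, app_map_op]

/-- Restriction of cocycles along a map. -/
def pullCocycle (p : ℕ) : Cocycle K T p →ₗ[K] Cocycle K S p :=
  (pullCochain K φ p).restrict fun f hf => by
    have hf' : coboundary K p f = 0 := hf
    change coboundary K p (pullCochain K φ p f) = 0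
    rw [coboundary_pull, hf', map_zero]

theorem pull_mem_coboundaries {p : ℕ} {f : Cochain K T p} (hf : f ∈ Coboundaries K T p) :
    pullCochain K φ p f ∈ Coboundaries K S p := by
  cases p with
  | zero =>
    have : f = 0 := hf
    simp [this]
  | succ p =>
    obtain ⟨k, rfl⟩ := hf
    exact ⟨pullCochain K φ p k, coboundary_pull K φ k⟩

/-- The map induced in cohomology of degree `p`. -/
def pullCohomology (p : ℕ) : Cohomology K T p →ₗ[K] Cohomology K S p :=
  Submodule.mapQ _ _ (pullCocycle K φ p) fun _ hf => pull_mem_coboundaries K φ hf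

theorem pullCohomology_cohClass {p : ℕ} (z : Cocycle K T p) :
    pullCohomology K φ p (cohClass K z) = cohClass K (pullCocycle K φ p z) := rfl

/-- The ring homomorphism induced in cohomology. -/
def pullRing : CohomologyRing K T →+* CohomologyRing K S :=
  DirectSum.toSemiring
    (fun p => (DirectSum.of (Cohomology K S) p).comp (pullCohomology K φ p).toAddMonoidHom)
    rfl
    (fun {p q} a b => by
      obtain ⟨f, rfl⟩ := cohClass_surjective K a
      obtain ⟨g, rfl⟩ := cohClass_surjective K b
      change _ = DirectSum.of (Cohomology K S) p (cohClass K (pullCocycle K φ p f)) *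
        DirectSum.of (Cohomology K S) q (cohClass K (pullCocycle K φ q g))
      rw [DirectSum.of_mul_of]
      change DirectSum.of (Cohomology K S) (p + q)
          (cohClass K (pullCocycle K φ (p + q) (cupCocycle K rfl f g))) =
        DirectSum.of (Cohomology K S) (p + q)
          (cohClass K (cupCocycle K rfl (pullCocycle K φ p f) (pullCocycle K φ q g)))
      congr 2
      ext τ
      change (f : Cochain K T p) (T.map _ (φ.app _ τ)) * (g : Cochain K T q) (T.map _ (φ.app _ τ)) =
        (f : Cochain K T p) (φ.app _ (S.map _ τ)) * (g : Cochain K T q) (φ.app _ (S.map _ τ))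
      rw [app_map_op, app_map_op])

theorem pullRing_of {p : ℕ} (x : Cohomology K T p) :
    pullRing K φ (DirectSum.of (Cohomology K T) p x) =
      DirectSum.of (Cohomology K S) p (pullCohomology K φ p x) :=
  DirectSum.toSemiring_of _ _ _ _ _

end Functoriality

/-! ### Length of a graded ring and the persistent cup-length invariant -/

section Invariant

/-- The length of a graded ring `R = ⨁ₚ 𝒜 p`: the largest `n` for which there are `n` homogeneous
elements of positive degree with non-zero product (`⊤` if there is no largest one, `0` if there is
no such `n` at all). -/
def gradedLength {R : Type*} [Ring R] (𝒜 : ℕ → AddSubgroup R) : ℕ∞ :=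
  sSup {ℓ : ℕ∞ | ∃ n : ℕ, ℓ = n ∧ ∃ η : Fin n → R,
    (∀ k, ∃ p : ℕ, 1 ≤ p ∧ η k ∈ 𝒜 p) ∧ (List.ofFn η).prod ≠ 0}

variable (K : Type v) [Field K]

/-- The length of the image of the ring map induced in cohomology by `φ`; the image is a subring of
`H^*(S)`, with the grading that it inherits from `H^*(S)`. -/
def imageLength {S T : SSet.{u}} (φ : S ⟶ T) : ℕ∞ :=
  gradedLength (R := (pullRing K φ).range) fun p =>
    (degreePart K S p).toAddSubgroup.comap ((pullRing K φ).range.subtype : _ →+ _)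

/-- The singular simplicial set of the space `X_t`. Its cochains, cohomology and cup product are
the singular cochains, singular cohomology and cup product of `X_t`. -/
abbrev sing (X : ℝ ⥤ TopCat.{u}) (t : ℝ) : SSet.{u} := TopCat.toSSet.obj (X.obj t)

/-- The map of singular simplicial sets induced by the transition map `X_s ⟶ X_t`, `s ≤ t`. -/
def incl (X : ℝ ⥤ TopCat.{u}) {s t : ℝ} (h : s ≤ t) : sing X s ⟶ sing X t :=
  TopCat.toSSet.map (X.map (homOfLE h))

/-- The persistent cup-length invariant: `[a, b] ↦ len (im (H^*(X_b) → H^*(X_a)))`. -/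
def persistentCupLength (X : ℝ ⥤ TopCat.{u}) {a b : ℝ} (hab : a ≤ b) : ℕ∞ :=
  imageLength K (incl X hab)

end Invariant

/-! ### Representative cocycles and the persistent cup-length diagram -/

section Diagram

/-- A family of representative cocycles for the positive-degree barcode of a persistent space `X`.

The bars, with their degrees, are indexed by `ι` (a bar may occur several times). A representative
cocycle of a bar `I` is a cocycle on `⋃_{t ∈ I} X_t`, given through its restrictions to the `X_t`,
`t ∈ I`; if `I` has a last point `d`, it amounts to a cocycle on `X_d`. Its class has to vanish
below `I`, and at each `t` the classes of the bars through `t` have to form a basis of `H^+(X_t)`.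
Thus the cocycles give a decomposition of the persistence module `H^+(X)` into the interval modules
of the bars, in other words, the bars are its barcode. -/
structure RepresentativeCocycles (K : Type v) [Field K] (X : ℝ ⥤ TopCat.{u}) where
  /-- The index set of the barcode. -/
  ι : Type w
  /-- The degree of a bar. -/
  deg : ι → ℕ
  deg_pos : ∀ i, 1 ≤ deg i
  /-- The bar itself, an interval of the real line. -/
  bar : ι → Set ℝ
  bar_nonempty : ∀ i, (bar i).Nonempty
  bar_ordConnected : ∀ i, (bar i).OrdConnected
  /-- The restriction to `X_t` of the representative cocycle. -/
  cocycle : ∀ i (t : bar i), Cocycle K (sing X t) (deg i)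
  cocycle_restrict : ∀ i (s t : bar i) (h : (s : ℝ) ≤ t),
    pullCocycle K (incl X h) (deg i) (cocycle i t) = cocycle i s
  class_eq_zero : ∀ i (t : bar i) (s : ℝ) (h : s ≤ t), s ∉ bar i →
    cohClass K (pullCocycle K (incl X h) (deg i) (cocycle i t)) = 0
  linearIndependent : ∀ t : ℝ, LinearIndependent K fun i : {i : ι // t ∈ bar i} =>
    DirectSum.of (Cohomology K (sing X t)) (deg i.1) (cohClass K (cocycle i.1 ⟨t, i.2⟩))
  span_eq : ∀ t : ℝ, Submodule.span K (Set.range fun i : {i : ι // t ∈ bar i} =>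
    DirectSum.of (Cohomology K (sing X t)) (deg i.1) (cohClass K (cocycle i.1 ⟨t, i.2⟩))) =
      positivePart K (sing X t)

variable {K : Type v} [Field K] {X : ℝ ⥤ TopCat.{u}} (σ : RepresentativeCocycles.{u, v, w} K X)

open Classical in
/-- The class `[σ_I]_t` in `H^*(X_t)` of the representative cocycle of a bar `I`. It is zero for
`t` outside `I`: below `I` this is the class of the restriction, above `I` it is a convention. -/
def RepresentativeCocycles.classAt (i : σ.ι) (t : ℝ) : CohomologyRing K (sing X t) :=
  if h : t ∈ σ.bar i then
    DirectSum.of (Cohomology K (sing X t)) (σ.deg i) (cohClass K (σ.cocycle i ⟨t, h⟩))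
  else 0

/-- The support of `σ_{I₁} ⌣ ⋯ ⌣ σ_{Iₙ}`: all `t` with `[σ_{I₁}]_t ⌣ ⋯ ⌣ [σ_{Iₙ}]_t ≠ 0`. -/
def RepresentativeCocycles.support {n : ℕ} (I : Fin n → σ.ι) : Set ℝ :=
  {t | (List.ofFn fun k => σ.classAt (I k) t).prod ≠ 0}

/-- The persistent cup-length diagram: an interval `J` goes to the largest `n ≥ 1` for which `J` is
the support of an `n`-fold product of representative cocycles (`0` if there is no such `n`, `⊤` if
there is no largest one). -/
def RepresentativeCocycles.diagram (J : Set ℝ) : ℕ∞ :=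
  sSup {ℓ : ℕ∞ | ∃ n : ℕ, 1 ≤ n ∧ ℓ = n ∧ ∃ I : Fin n → σ.ι, J = σ.support I}

/-- What is required of a finite end of an interval. -/
inductive EndKind
  | closedEnd
  | openEnd
  | anyEnd

/-- `e.Admits P`: an end may be of kind `e` if `P` says that the end belongs to the interval. -/
def EndKind.Admits : EndKind → Prop → Prop
  | .closedEnd, P => P
  | .openEnd, P => ¬ P
  | .anyEnd, _ => True

/-- The non-empty intervals of the real line, bounded or not, whose finite left end is of kind `l`
and whose finite right end is of kind `r`. -/
def Intervals (l r : EndKind) : Set (Set ℝ) :=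
  {J | J.Nonempty ∧ J.OrdConnected ∧ (∀ x, IsGLB J x → l.Admits (x ∈ J)) ∧
    (∀ x, IsLUB J x → r.Admits (x ∈ J))}

end Diagram

end PersistentCup

end

/-! Cup-length at `[a, b]` and products of representative cocycles are compared by multilinearity. A
homogeneous element of positive degree in the image of `H^*(X_b) → H^*(X_a)` lifts to one of the
same degree over `b`, hence is a combination of restrictions to `a` of classes of bars through `b`.
Expanding a non-zero product of such elements gives a non-zero product of representative classes at
`a`, all of whose bars contain `b`. Its support contains `[a, b]` (`exists_subset_support`).
Conversely, if a support contains `[a, b]`, its classes at `a` lie in the image and have non-zero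
product (`le_persistentCupLength`).

It remains to see that a non-empty support of at least one factor lies in the class of intervals
containing the bars. Fix a point `t` of it. Above `t` the support is the intersection of the bars of
the factors, because a product that restricts to something non-zero is non-zero
(`mem_support_iff_of_ge`). Below `t`, expand the product at `t` in the basis of bar classes:
restriction keeps the coefficients and kills the bars that have not begun, while the others stay
independent. So the support is there a finite union of bars (`exists_finset_mem_support_iff`). Hence
each finite end of the support has the type of an end of some bar. -/

namespace PersistentCup

/-! ### Multilinear expansion and homogeneous elements of the cohomology ring -/

section Algebra

/-- If a product of elements of the span of a family is non-zero, then so is some product of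
members of the family. -/
theorem exists_mul_prod_ne_zero {K R ι : Type*} [Field K] [Ring R] [Module K R]
    [IsScalarTower K R R] [SMulCommClass K R R] (v : ι → R) :
    ∀ {n : ℕ} (η : Fin n → R) (x : R), (∀ k, η k ∈ Submodule.span K (Set.range v)) →
      x * (List.ofFn η).prod ≠ 0 → ∃ I : Fin n → ι, x * (List.ofFn fun k => v (I k)).prod ≠ 0
  | 0, _, _, _, hne => ⟨Fin.elim0, by simpa using hne⟩
  | n + 1, η, x, hη, hne => by
    by_contra! hI
    refine hne ?_
    rw [List.ofFn_succ, List.prod_cons, ← mul_assoc]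
    -- The product is linear in the first factor, so it is enough to kill it when that factor is a
    -- generator; the generator then joins the prefix `x` in the recursion.
    have h0 := hη 0
    generalize η 0 = w at h0 ⊢
    induction h0 using Submodule.span_induction with
    | mem y hy =>
      obtain ⟨i, rfl⟩ := hy
      by_contra hi
      obtain ⟨I, hI'⟩ := exists_mul_prod_ne_zero v (fun k => η k.succ) (x * v i)
        (fun k => hη k.succ) hi
      refine hI' ?_
      simpa [List.ofFn_succ, mul_assoc] using hI (Fin.cons i I)
    | zero => simp
    | add y z _ _ hy hz => rw [mul_add, add_mul, hy, hz, add_zero]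
    | smul c y _ hy => rw [mul_smul_comm, smul_mul_assoc, hy, smul_zero]

theorem exists_prod_ne_zero {K R ι : Type*} [Field K] [Ring R] [Module K R]
    [IsScalarTower K R R] [SMulCommClass K R R] (v : ι → R) {n : ℕ} (η : Fin n → R)
    (hη : ∀ k, η k ∈ Submodule.span K (Set.range v)) (hne : (List.ofFn η).prod ≠ 0) :
    ∃ I : Fin n → ι, (List.ofFn fun k => v (I k)).prod ≠ 0 := by
  simpa using exists_mul_prod_ne_zero (K := K) v η 1 hη (by simpa using hne)

variable {K : Type v} [Field K] {S T : SSet.{u}}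

theorem smul_of (c : K) {p : ℕ} (x : Cohomology K S p) :
    c • DirectSum.of (Cohomology K S) p x = DirectSum.of (Cohomology K S) p (c • x) :=
  ((DirectSum.lof K ℕ (Cohomology K S) p).map_smul c x).symm

/-- With the commutation instance below, this lets scalars leave any factor of a product, as the
multilinear expansion requires. By additivity it reduces to bilinearity of `cup` on homogeneous
elements. -/
instance : IsScalarTower K (CohomologyRing K S) (CohomologyRing K S) where
  smul_assoc c x y := by
    simp only [smul_eq_mul]
    induction x using DirectSum.induction_on with
    | zero => simp
    | add x x' hx hx' => rw [smul_add, add_mul, add_mul, hx, hx', smul_add]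
    | of p x =>
      induction y using DirectSum.induction_on with
      | zero => simp
      | add y y' hy hy' => rw [mul_add, mul_add, hy, hy', smul_add]
      | of q y =>
        rw [smul_of, DirectSum.of_mul_of, DirectSum.of_mul_of, smul_of]
        congr 1
        exact congrArg (· y) ((cup K (S := S) (rfl : p + q = p + q)).map_smul c x)

instance : SMulCommClass K (CohomologyRing K S) (CohomologyRing K S) where
  smul_comm c x y := by
    simp only [smul_eq_mul]
    induction x using DirectSum.induction_on with
    | zero => simp
    | add x x' hx hx' => rw [add_mul, add_mul, ← hx, ← hx', smul_add]
    | of p x =>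
      induction y using DirectSum.induction_on with
      | zero => simp
      | add y y' hy hy' => rw [mul_add, smul_add, smul_add, mul_add, hy, hy']
      | of q y =>
        rw [smul_of, DirectSum.of_mul_of, DirectSum.of_mul_of, smul_of]
        congr 1
        exact ((cup K (S := S) (rfl : p + q = p + q) x).map_smul c y).symm

theorem pullRing_smul (φ : S ⟶ T) (c : K) (x : CohomologyRing K T) :
    pullRing K φ (c • x) = c • pullRing K φ x := by
  induction x using DirectSum.induction_on with
  | zero => simp
  | add x y hx hy => rw [smul_add, map_add, hx, hy, map_add, smul_add]
  | of p x => rw [smul_of, pullRing_of, pullRing_of, map_smul, smul_of]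

theorem of_mem_positivePart {p : ℕ} (hp : 1 ≤ p) (x : Cohomology K S p) :
    DirectSum.of (Cohomology K S) p x ∈ positivePart K S := by
  obtain ⟨p, rfl⟩ := Nat.exists_eq_add_of_le' hp
  exact Submodule.mem_iSup_of_mem p ⟨x, rfl⟩

/-- A product of homogeneous elements of positive degree is homogeneous, of degree at least the
number of factors. -/
theorem exists_prod_eq_of : ∀ {n : ℕ} (η : Fin n → CohomologyRing K S),
    (∀ k, ∃ p : ℕ, 1 ≤ p ∧ ∃ x, η k = DirectSum.of (Cohomology K S) p x) →
      ∃ q : ℕ, n ≤ q ∧ ∃ x, (List.ofFn η).prod = DirectSum.of (Cohomology K S) q x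
  | 0, _, _ => ⟨0, le_rfl, GradedMonoid.GOne.one, by simp [DirectSum.one_def]⟩
  | n + 1, η, h => by
    obtain ⟨p, hp, x, hx⟩ := h 0
    obtain ⟨q, hq, y, hy⟩ := exists_prod_eq_of (fun k => η k.succ) fun k => h k.succ
    refine ⟨p + q, by omega, GradedMonoid.GMul.mul x y, ?_⟩
    rw [List.ofFn_succ, List.prod_cons, hx, hy, DirectSum.of_mul_of]

/-- A homogeneous element of the image of the induced map is the image of a homogeneous element. -/
theorem exists_pullRing_of (φ : S ⟶ T) {p : ℕ} {x : CohomologyRing K S}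
    (hx : x ∈ degreePart K S p) (hr : x ∈ (pullRing K φ).range) :
    ∃ y, pullRing K φ (DirectSum.of (Cohomology K T) p y) = x := by
  obtain ⟨x, rfl⟩ := hx
  obtain ⟨z, hz⟩ := hr
  -- Pull-back commutes with projection to degree `p`, so the degree-`p` component of any preimage
  -- will do.
  refine ⟨z p, ?_⟩
  have key : ∀ w : CohomologyRing K T, (pullRing K φ w) p = pullCohomology K φ p (w p) := by
    intro w
    induction w using DirectSum.induction_on with
    | zero => simp
    | add w w' hw hw' => rw [map_add, DirectSum.add_apply, hw, hw', DirectSum.add_apply, map_add]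
    | of q w =>
      rw [pullRing_of]
      by_cases h : q = p
      · subst h
        rw [DirectSum.of_eq_same, DirectSum.of_eq_same]
      · rw [DirectSum.of_eq_of_ne _ _ _ (Ne.symm h), DirectSum.of_eq_of_ne _ _ _ (Ne.symm h),
          map_zero]
  rw [pullRing_of, ← key, hz]
  change DirectSum.of _ p ((DirectSum.of (Cohomology K S) p x) p) = _
  rw [DirectSum.of_eq_same]
  rfl

end Algebra

/-- The whole line has no finite ends to test. It keeps the supremum over a non-empty family and
serves the empty product. -/
theorem univ_mem_intervals (l r : EndKind) : Set.univ ∈ Intervals l r :=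
  ⟨Set.univ_nonempty, Set.ordConnected_univ, fun x hx => absurd ⟨x, hx.1⟩ not_bddBelow_univ,
    fun x hx => absurd ⟨x, hx.1⟩ not_bddAbove_univ⟩

/-! ### Restriction of representative classes and the shape of supports -/

namespace RepresentativeCocycles

variable {K : Type v} [Field K] {X : ℝ ⥤ TopCat.{u}} (σ : RepresentativeCocycles.{u, v, w} K X)

theorem classAt_of_mem {i : σ.ι} {t : ℝ} (h : t ∈ σ.bar i) :
    σ.classAt i t =
      DirectSum.of (Cohomology K (sing X t)) (σ.deg i) (cohClass K (σ.cocycle i ⟨t, h⟩)) :=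
  dif_pos h

theorem classAt_of_notMem {i : σ.ι} {t : ℝ} (h : t ∉ σ.bar i) : σ.classAt i t = 0 :=
  dif_neg h

/-- Inside the bar the cocycles are compatible; below it the restricted class vanishes. The bar must
contain `t`: above a bar the class is zero by convention and says nothing about `s`. -/
theorem pullRing_classAt {s t : ℝ} (h : s ≤ t) {i : σ.ι} (ht : t ∈ σ.bar i) :
    pullRing K (incl X h) (σ.classAt i t) = σ.classAt i s := by
  rw [σ.classAt_of_mem ht, pullRing_of, pullCohomology_cohClass]
  by_cases hs : s ∈ σ.bar i
  · rw [σ.classAt_of_mem hs, σ.cocycle_restrict i ⟨s, hs⟩ ⟨t, ht⟩ h]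
  · rw [σ.classAt_of_notMem hs, σ.class_eq_zero i ⟨t, ht⟩ s h hs, map_zero]

theorem pullRing_prod_classAt {s t : ℝ} (h : s ≤ t) {n : ℕ} {I : Fin n → σ.ι}
    (ht : ∀ k, t ∈ σ.bar (I k)) :
    pullRing K (incl X h) (List.ofFn fun k => σ.classAt (I k) t).prod =
      (List.ofFn fun k => σ.classAt (I k) s).prod := by
  rw [map_list_prod, List.map_ofFn]
  congr 2
  funext k
  exact σ.pullRing_classAt h (ht k)

theorem linearIndepOn_classAt (t : ℝ) :
    LinearIndepOn K (fun i => σ.classAt i t) {i | t ∈ σ.bar i} := by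
  have h : (fun i : {i : σ.ι // t ∈ σ.bar i} => σ.classAt i.1 t) = fun i =>
      DirectSum.of (Cohomology K (sing X t)) (σ.deg i.1) (cohClass K (σ.cocycle i.1 ⟨t, i.2⟩)) :=
    funext fun i => σ.classAt_of_mem i.2
  have := σ.linearIndependent t
  rw [← h] at this
  exact this

theorem span_classAt (t : ℝ) :
    Submodule.span K (Set.range fun i : {i : σ.ι // t ∈ σ.bar i} => σ.classAt i.1 t) =
      positivePart K (sing X t) := by
  rw [← σ.span_eq t]
  congr 2
  exact funext fun i => σ.classAt_of_mem i.2

theorem mem_bar_of_mem_support {n : ℕ} {I : Fin n → σ.ι} {t : ℝ} (ht : t ∈ σ.support I)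
    (k : Fin n) : t ∈ σ.bar (I k) := by
  by_contra hk
  refine ht (List.prod_eq_zero ?_)
  rw [List.mem_ofFn]
  exact ⟨k, σ.classAt_of_notMem hk⟩

/-- Above one of its points, the support is the intersection of the bars. -/
theorem mem_support_iff_of_ge {n : ℕ} {I : Fin n → σ.ι} {t u : ℝ} (ht : t ∈ σ.support I)
    (htu : t ≤ u) : u ∈ σ.support I ↔ ∀ k, u ∈ σ.bar (I k) := by
  refine ⟨fun hu k => σ.mem_bar_of_mem_support hu k, fun hu h0 => ht ?_⟩
  rw [← σ.pullRing_prod_classAt htu hu, h0, map_zero]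

/-- Below one of its points `t`, the support is a finite union of bars through `t`. -/
theorem exists_finset_mem_support_iff {n : ℕ} (hn : 1 ≤ n) {I : Fin n → σ.ι} {t : ℝ}
    (ht : t ∈ σ.support I) :
    ∃ F : Finset σ.ι, (∀ i ∈ F, t ∈ σ.bar i) ∧
      ∀ s ≤ t, (s ∈ σ.support I ↔ ∃ i ∈ F, s ∈ σ.bar i) := by
  classical
  -- Since `n ≥ 1`, the product has positive degree, so the classes of the bars through `t` span it;
  -- the empty product, of degree 0, would escape.
  obtain ⟨q, hq, z, hz⟩ := exists_prod_eq_of (fun k => σ.classAt (I k) t) fun k =>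
    ⟨_, σ.deg_pos (I k), _, σ.classAt_of_mem (σ.mem_bar_of_mem_support ht k)⟩
  have hpos := of_mem_positivePart (hn.trans hq) z
  rw [← hz, ← σ.span_classAt t, Finsupp.mem_span_range_iff_exists_finsupp] at hpos
  obtain ⟨c, hc⟩ := hpos
  -- Coefficients extended by zero to all bars, so that the same family can be used at every `s ≤
  -- t`.
  let d : σ.ι →₀ K := c.embDomain (Function.Embedding.subtype _)
  have hd : ∀ i ∈ d.support, t ∈ σ.bar i := by
    intro i hi
    rw [Finsupp.support_embDomain, Finset.mem_map] at hi
    obtain ⟨j, -, rfl⟩ := hi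
    exact j.2
  have hsum : (List.ofFn fun k => σ.classAt (I k) t).prod =
      ∑ i ∈ d.support, d i • σ.classAt i t := by
    rw [← hc]
    exact (Finsupp.sum_embDomain (f := Function.Embedding.subtype _) (v := c)
      (g := fun i a => a • σ.classAt i t)).symm
  refine ⟨d.support, hd, fun s hs => ?_⟩
  have hsum' : (List.ofFn fun k => σ.classAt (I k) s).prod =
      ∑ i ∈ d.support, d i • σ.classAt i s := by
    rw [← σ.pullRing_prod_classAt hs fun k => σ.mem_bar_of_mem_support ht k, hsum, map_sum]
    exact Finset.sum_congr rfl fun i hi => by rw [pullRing_smul, σ.pullRing_classAt hs (hd i hi)]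
  change (List.ofFn fun k => σ.classAt (I k) s).prod ≠ 0 ↔ _
  rw [hsum']
  constructor
  · intro hne
    by_contra! hF
    exact hne (Finset.sum_eq_zero fun i hi => by rw [σ.classAt_of_notMem (hF i hi), smul_zero])
  · rintro ⟨i, hi, hsi⟩ h0
    -- Only bars through `s` contribute, and their classes are independent, so a coefficient from
    -- `d.support` would have to vanish.
    rw [← Finset.sum_filter_of_ne (p := fun i => s ∈ σ.bar i)] at h0
    · have := linearIndepOn_iff'.1 (σ.linearIndepOn_classAt s)
        (d.support.filter fun i => s ∈ σ.bar i) d (fun j hj => (Finset.mem_filter.1 hj).2) h0 i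
        (Finset.mem_filter.2 ⟨hi, hsi⟩)
      exact Finsupp.mem_support_iff.1 hi this
    · intro j _ hj
      by_contra hsj
      exact hj (by rw [σ.classAt_of_notMem hsj, smul_zero])

/-- Above its point `s` the support is an intersection of order-convex bars. -/
theorem ordConnected_support {n : ℕ} (I : Fin n → σ.ι) : (σ.support I).OrdConnected := by
  refine ⟨fun s hs t ht x hx => (σ.mem_support_iff_of_ge hs hx.1).2 fun k => ?_⟩
  exact (σ.bar_ordConnected (I k)).out (σ.mem_bar_of_mem_support hs k)
    (σ.mem_bar_of_mem_support ht k) hx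

/-! ### Ends of a support -/

theorem leftEnd_support {l : EndKind}
    (hl : ∀ i x, IsGLB (σ.bar i) x → l.Admits (x ∈ σ.bar i)) {n : ℕ} (hn : 1 ≤ n)
    {I : Fin n → σ.ι} (hI : (σ.support I).Nonempty) {x : ℝ} (hx : IsGLB (σ.support I) x) :
    l.Admits (x ∈ σ.support I) := by
  obtain ⟨t, ht⟩ := hI
  obtain ⟨F, hFt, hF⟩ := σ.exists_finset_mem_support_iff hn ht
  have hxt : x ≤ t := hx.1 ht
  -- A point of such a bar below `x` would lie below `t`, hence in the support.
  have hlow : ∀ i ∈ F, x ∈ lowerBounds (σ.bar i) := by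
    intro i hi y hy
    by_contra! hyx
    exact hyx.not_ge (hx.1 ((hF y (hyx.le.trans hxt)).2 ⟨i, hi, hy⟩))
  cases l with
  | anyEnd => trivial
  | openEnd =>
    intro hxs
    obtain ⟨i, hi, hxi⟩ := (hF x hxt).1 hxs
    exact hl i x ⟨hlow i hi, fun y hy => hy hxi⟩ hxi
  | closedEnd =>
    refine (hF x hxt).2 ?_
    by_contra! hxF
    -- A bar of `F` with infimum `x` would contain `x`. So each has a lower bound beyond `x`, and
    -- the least of these finitely many bounds the support below, contradicting the choice of `x`.
    have hy : ∀ i ∈ F, ∃ y, y ∈ lowerBounds (σ.bar i) ∧ x < y := by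
      intro i hi
      by_contra! hy
      exact hxF i hi (hl i x ⟨hlow i hi, fun y hyi => hy y hyi⟩)
    choose! y hyl hxy using hy
    have hne : F.Nonempty := ((hF t le_rfl).1 ht).imp fun _ h => h.1
    obtain ⟨j, hj, hjmin⟩ := F.exists_min_image y hne
    refine (hxy j hj).not_ge (hx.2 fun s hs => ?_)
    rcases le_total s t with hst | hts
    · obtain ⟨i, hi, hsi⟩ := (hF s hst).1 hs
      exact (hjmin i hi).trans (hyl i hi hsi)
    · exact (hyl j hj (hFt j hj)).trans hts

theorem rightEnd_support {r : EndKind}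
    (hr : ∀ i x, IsLUB (σ.bar i) x → r.Admits (x ∈ σ.bar i)) {n : ℕ} (hn : 1 ≤ n)
    {I : Fin n → σ.ι} (hI : (σ.support I).Nonempty) {x : ℝ} (hx : IsLUB (σ.support I) x) :
    r.Admits (x ∈ σ.support I) := by
  obtain ⟨t, ht⟩ := hI
  have htx : t ≤ x := hx.1 ht
  have htI := σ.mem_bar_of_mem_support ht
  cases r with
  | anyEnd => trivial
  | openEnd =>
    intro hxs
    have hxI := σ.mem_bar_of_mem_support hxs
    -- A bar ending at `x` may not contain `x`, so every factor's bar continues past `x`. The least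
    -- of the chosen points, available as `n ≥ 1`, lies in all bars and extends the support beyond
    -- its supremum.
    have hy : ∀ k, ∃ y ∈ σ.bar (I k), x < y := by
      intro k
      by_contra! hy
      exact hr (I k) x ⟨hy, fun y hyk => hyk (hxI k)⟩ (hxI k)
    choose y hyI hxy using hy
    have : Nonempty (Fin n) := ⟨⟨0, hn⟩⟩
    obtain ⟨j, hj⟩ := Finite.exists_min y
    refine (hxy j).not_ge (hx.1 ((σ.mem_support_iff_of_ge hxs (hxy j).le).2 fun k => ?_))
    exact (σ.bar_ordConnected (I k)).out (hxI k) (hyI k) ⟨(hxy j).le, hj k⟩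
  | closedEnd =>
    refine (σ.mem_support_iff_of_ge ht htx).2 fun k => ?_
    by_contra hxk
    -- A bar through `t` that misses `x` cannot pass `x`. As it contains the support, its supremum
    -- is exactly `x`, so it would have to contain `x`.
    have hup : x ∈ upperBounds (σ.bar (I k)) := by
      intro y hy
      by_contra! hxy
      exact hxk ((σ.bar_ordConnected (I k)).out (htI k) hy ⟨htx, hxy.le⟩)
    exact hxk (hr (I k) x ⟨hup, fun y hy =>
      hx.2 fun s hs => hy (σ.mem_bar_of_mem_support hs k)⟩)

theorem support_mem_intervals {l r : EndKind} (hσ : ∀ i, σ.bar i ∈ Intervals l r) {n : ℕ}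
    (hn : 1 ≤ n) {I : Fin n → σ.ι} (hI : (σ.support I).Nonempty) :
    σ.support I ∈ Intervals l r :=
  ⟨hI, σ.ordConnected_support I,
    fun _ => σ.leftEnd_support (fun i => (hσ i).2.2.1) hn hI,
    fun _ => σ.rightEnd_support (fun i => (hσ i).2.2.2) hn hI⟩

/-! ### Comparison of the cup-length with the diagram -/

/-- Every non-zero product in the image of `H^*(X_b) → H^*(X_a)` comes from a product of
representative cocycles whose support contains `[a, b]`. -/
theorem exists_subset_support {a b : ℝ} (hab : a ≤ b) {n : ℕ}
    (η : Fin n → (pullRing K (incl X hab)).range)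
    (hη : ∀ k, ∃ p : ℕ, 1 ≤ p ∧ (η k : CohomologyRing K (sing X a)) ∈ degreePart K (sing X a) p)
    (hne : (List.ofFn η).prod ≠ 0) : ∃ I : Fin n → σ.ι, Set.Icc a b ⊆ σ.support I := by
  have hne' : (List.ofFn fun k => (η k : CohomologyRing K (sing X a))).prod ≠ 0 := by
    intro h0
    refine hne (Subtype.ext ?_)
    rw [SubmonoidClass.coe_list_prod, List.map_ofFn]
    exact h0
  -- The spanning family consists of classes at `a` but is indexed by bars through `b`; some of them
  -- may vanish at `a`. This indexing is what later puts `b` in the support.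
  obtain ⟨I, hI⟩ := exists_prod_ne_zero (K := K)
    (fun i : {i : σ.ι // b ∈ σ.bar i} => σ.classAt i.1 a) _ (fun k => by
      obtain ⟨p, hp, hk⟩ := hη k
      obtain ⟨y, hy⟩ := exists_pullRing_of (incl X hab) hk (η k).2
      have hmem := of_mem_positivePart hp y
      rw [← σ.span_classAt b] at hmem
      rw [← hy]
      generalize DirectSum.of (Cohomology K (sing X b)) p y = w at hmem
      induction hmem using Submodule.span_induction with
      | mem z hz =>
        obtain ⟨i, rfl⟩ := hz
        rw [σ.pullRing_classAt hab i.2]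
        exact Submodule.subset_span ⟨i, rfl⟩
      | zero => rw [map_zero]; exact zero_mem _
      | add z z' _ _ hz hz' => rw [map_add]; exact add_mem hz hz'
      | smul c z _ hz => rw [pullRing_smul]; exact Submodule.smul_mem _ _ hz) hne'
  have ha : a ∈ σ.support fun k => (I k).1 := hI
  exact ⟨fun k => (I k).1, fun t ht => (σ.ordConnected_support _).out ha
    ((σ.mem_support_iff_of_ge ha hab).2 fun k => (I k).2) ht⟩

/-- That `b` is in the support forces every bar to contain `b`, so the classes at `a` are
restrictions from `b`; that `a` is in it makes their product non-zero. -/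
theorem le_persistentCupLength {a b : ℝ} (hab : a ≤ b) {n : ℕ} {I : Fin n → σ.ι}
    (hI : Set.Icc a b ⊆ σ.support I) : (n : ℕ∞) ≤ persistentCupLength K X hab := by
  have ha : a ∈ σ.support I := hI ⟨le_rfl, hab⟩
  have hb : b ∈ σ.support I := hI ⟨hab, le_rfl⟩
  refine le_sSup ⟨n, rfl, fun k => (⟨σ.classAt (I k) a, ⟨σ.classAt (I k) b,
    σ.pullRing_classAt hab (σ.mem_bar_of_mem_support hb k)⟩⟩ : (pullRing K (incl X hab)).range),
    fun k => ⟨σ.deg (I k), σ.deg_pos _, ?_⟩, fun h0 => ha ?_⟩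
  · change σ.classAt (I k) a ∈ degreePart K (sing X a) (σ.deg (I k))
    rw [σ.classAt_of_mem (σ.mem_bar_of_mem_support ha k)]
    exact ⟨_, rfl⟩
  · have := congrArg Subtype.val h0
    rw [SubmonoidClass.coe_list_prod, List.map_ofFn] at this
    exact this

theorem diagram_le_persistentCupLength {a b : ℝ} (hab : a ≤ b) {J : Set ℝ}
    (hJ : Set.Icc a b ⊆ J) : σ.diagram J ≤ persistentCupLength K X hab := by
  refine sSup_le ?_
  rintro _ ⟨n, -, rfl, I, rfl⟩
  exact σ.le_persistentCupLength hab hJ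

theorem exists_le_diagram {l r : EndKind} (hσ : ∀ i, σ.bar i ∈ Intervals l r) {a b : ℝ}
    (hab : a ≤ b) {n : ℕ} (η : Fin n → (pullRing K (incl X hab)).range)
    (hη : ∀ k, ∃ p : ℕ, 1 ≤ p ∧ (η k : CohomologyRing K (sing X a)) ∈ degreePart K (sing X a) p)
    (hne : (List.ofFn η).prod ≠ 0) :
    ∃ J, (J ∈ Intervals l r ∧ Set.Icc a b ⊆ J) ∧ (n : ℕ∞) ≤ σ.diagram J := by
  -- The diagram ignores empty products, but for `n = 0` any admissible interval suffices.
  rcases Nat.eq_zero_or_pos n with rfl | hn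
  · exact ⟨Set.univ, ⟨univ_mem_intervals l r, Set.subset_univ _⟩, by simp⟩
  · obtain ⟨I, hI⟩ := σ.exists_subset_support hab η hη hne
    exact ⟨σ.support I, ⟨σ.support_mem_intervals hσ hn ⟨a, hI ⟨le_rfl, hab⟩⟩, hI⟩,
      le_sSup ⟨n, hn, rfl, I, rfl⟩⟩

end RepresentativeCocycles

end PersistentCup

theorem mainTheorem8 {K : Type v} [Field K] (X : ℝ ⥤ TopCat.{u})
    (σ : PersistentCup.RepresentativeCocycles.{u, v, w} K X) (l r : PersistentCup.EndKind)
    (hσ : ∀ i, σ.bar i ∈ PersistentCup.Intervals l r) (a b : ℝ) (hab : a ≤ b) :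
    (PersistentCup.persistentCupLength K X hab =
      ⨆ J ∈ {J | J ∈ PersistentCup.Intervals l r ∧ Set.Icc a b ⊆ J}, σ.diagram J) ∧
    (PersistentCup.persistentCupLength K X hab ≠ ⊤ →
      IsGreatest (σ.diagram '' {J | J ∈ PersistentCup.Intervals l r ∧ Set.Icc a b ⊆ J})
        (PersistentCup.persistentCupLength K X hab)) := by
  have hsup : PersistentCup.persistentCupLength K X hab =
      ⨆ J ∈ {J | J ∈ PersistentCup.Intervals l r ∧ Set.Icc a b ⊆ J}, σ.diagram J := by
    refine le_antisymm (sSup_le ?_)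
      (iSup₂_le fun J hJ => σ.diagram_le_persistentCupLength hab hJ.2)
    rintro _ ⟨n, rfl, η, hη, hne⟩
    obtain ⟨J, hJ, hle⟩ := σ.exists_le_diagram hσ hab η hη hne
    exact hle.trans (le_iSup₂_of_le J hJ le_rfl)
  refine ⟨hsup, fun hfin => ⟨?_, ?_⟩⟩
  · rw [← sSup_image] at hsup
    rw [hsup] at hfin ⊢
    -- A non-empty set in `ℕ∞` with finite supremum attains it.
    have hne : Nonempty (σ.diagram '' {J | J ∈ PersistentCup.Intervals l r ∧ Set.Icc a b ⊆ J}) :=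
      ⟨_, Set.univ, ⟨PersistentCup.univ_mem_intervals l r, Set.subset_univ _⟩, rfl⟩
    exact ENat.sSup_mem_of_nonempty_of_lt_top hfin.lt_top
  · rintro _ ⟨J, hJ, rfl⟩
    exact σ.diagram_le_persistentCupLength hab hJ.2
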